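/- Let $X$ be an infinite-dimensional separable Banach space over $\mathbb{K}=\mathbb{R}$ or $\mathbb{C}$. Then there are bounded linear operators $R$ and $K$ on $X$ such that $R=I+K$, where $I$ is the identity of $X$, and the following hold. 1. The sets $$A_R=\Bigl\{x\in X:\ \lim_{t\to\infty}\|R^t x\|=\infty\Bigr\}\quad\text{and}\quad B_R=\Bigl\{x\in X:\ \liminf_{t\to\infty}\|R^t x-x\|=0\Bigr\}$$ ($t$ running through the non-negative integers) form a partition of $X$, that is, they are disjoint and $A_R\cup B_R=X$, and both have non-empty interior. 2. $K$ is compact and, moreover, nuclear: there are continuous linear functionals $x_k^*\in X^*$ and vectors $x_k\in X$ $(k\ge 1)$ with $\sum_{k=1}^\infty\|x_k^*\|\,\|x_k\|<\infty$ and $K=\sum_{k=1}^\infty x_k\otimes x_k^*$, where $(x_k\otimes x_k^*)(x)=x_k^*(x)\,x_k$ and the series converges in operator norm. -/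

import Mathlib

open Filter Topology
open scoped ENNReal

/-- The set `A_R` of the vectors `x` with `‖R ^ t x‖ → ∞` as `t → ∞`. -/
def orbitsToInfinity {𝕜 X : Type*} [RCLike 𝕜] [NormedAddCommGroup X] [NormedSpace 𝕜 X]
    (R : X →L[𝕜] X) : Set X :=
  {x | Tendsto (fun t : ℕ => ‖(R ^ t) x‖) atTop atTop}

/-- The set `B_R` of the vectors `x` with `liminf ‖R ^ t x - x‖ = 0` as `t → ∞`. The lower limit is
taken in `[0, ∞]`, so that it is `∞` (and not a default value) when the norms tend to infinity. -/
def recurrentVectors {𝕜 X : Type*} [RCLike 𝕜] [NormedAddCommGroup X] [NormedSpace 𝕜 X]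
    (R : X →L[𝕜] X) : Set X :=
  {x | liminf (fun t : ℕ => ‖(R ^ t) x - x‖ₑ) atTop = 0}

/-- `N` is nuclear: `N = ∑ k, v k ⊗ φ k` with `∑ k, ‖φ k‖ * ‖v k‖ < ∞`, where `v ⊗ φ` is the
operator `x ↦ φ x • v` and the series of operators converges in norm. -/
def IsNuclearOperator {𝕜 X : Type*} [RCLike 𝕜] [NormedAddCommGroup X] [NormedSpace 𝕜 X]
    (N : X →L[𝕜] X) : Prop :=
  ∃ (φ : ℕ → (X →L[𝕜] 𝕜)) (v : ℕ → X),
    Summable (fun k => ‖φ k‖ * ‖v k‖) ∧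
    HasSum (fun k => (φ k).smulRight (v k)) N

/-! The operator is `R = I + K`, where `K` acts on a sequence of planes `span (u n, v n)` taken from a
bounded biorthogonal sequence. In the `n`-th plane `R` is a rotation of finite order
`period (n + 1)`, followed by a push `weight n * driver n x` along `u n`. The driving functionals
`driver n = f 0 + s n • f 1` use two further coordinates, which `R` leaves unchanged, so the
displacement `R ^ t x - x` is explicit in every plane (`SpiralData.hasSum_block`): it is the sum of
`(ρ ^ t - 1)` applied to the plane coordinates of `x`, and of the pushes added up along the rotation.
The angles and the weights decrease so fast that `K` is nuclear.

Each period divides the next. At `t = period k` the planes before the `k`-th are back in place, and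
those after it have hardly moved; in the `k`-th plane the pushes add up to at most about
`Q k * |driver k x|`, where `Q k = weight k * period k → ∞`
(`SpiralData.norm_operator_pow_period_sub_le`). On the other hand, for every `t` there is a plane `n`
with `period n ≤ 6 * t < period (n + 1)`, in which the pushes add up to at least
`Q n / 12 * |driver n x|` (`SpiralData.le_norm_operator_pow`).

The points `s n` lie in the closed unit ball of the scalars, and every point `z` of it satisfies
`liminf Q n * |z - s n| = 0` (`exists_seq_frequently_mul_norm_sub_lt`). If `|f 1 x| < |f 0 x|`, then
`|driver n x|` is bounded below and the orbit tends to infinity. Otherwise `f 0 x + z * f 1 x = 0` for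
some `z` of the ball, so that `Q k * |driver k x|` has lower limit zero and `x` is recurrent. Both
cases contain a nonempty open set. It is essential that the biorthogonal sequence be bounded, since
the approximation by the `s n` cannot be adapted to fast growing norms; see
`exists_bounded_biorthogonal`. -/

/-! ### Bounded biorthogonal sequences -/

section Biorthogonal

variable {𝕜 : Type*} [RCLike 𝕜] {X : Type*} [NormedAddCommGroup X] [NormedSpace 𝕜 X]

/-- In an infinite-dimensional space, finitely many functionals vanish together on an
infinite-dimensional subspace. -/
theorem not_finiteDimensional_ker_pi (hX : ¬ FiniteDimensional 𝕜 X)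
    {ι : Type*} [Finite ι] (f : ι → X →L[𝕜] 𝕜) :
    ¬ FiniteDimensional 𝕜 (LinearMap.ker (LinearMap.pi fun i => (f i : X →ₗ[𝕜] 𝕜))) := by
  intro hfin
  apply hX
  set T : X →ₗ[𝕜] (ι → 𝕜) := LinearMap.pi fun i => (f i : X →ₗ[𝕜] 𝕜)
  have : FiniteDimensional 𝕜 (X ⧸ LinearMap.ker T) :=
    Module.Finite.equiv T.quotKerEquivRange.symm
  exact Module.Finite.of_submodule_quotient (LinearMap.ker T)

/-- A bounded `1`-separated sequence cannot stay close to a finite-dimensional subspace, because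
bounded sets of that subspace are totally bounded. -/
theorem exists_quarter_le_infDist (F : Submodule 𝕜 X) [FiniteDimensional 𝕜 F] {r : ℝ}
    {g : ℕ → X} (hg : ∀ n, ‖g n‖ ≤ r) (hsep : Pairwise fun m n => 1 ≤ ‖g m - g n‖) :
    ∃ n, 1 / 4 ≤ Metric.infDist (g n) F := by
  by_contra! h
  have hy : ∀ n, ∃ y : F, dist (g n) y < 1 / 4 := fun n => by
    obtain ⟨y, hyF, hy⟩ := (Metric.infDist_lt_iff ⟨0, F.zero_mem⟩).1 (h n)
    exact ⟨⟨y, hyF⟩, hy⟩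
  choose y hy using hy
  have : ProperSpace F := FiniteDimensional.proper_rclike 𝕜 F
  have hyb : ∀ n, y n ∈ Metric.closedBall (0 : F) (r + 1) := fun n => by
    rw [mem_closedBall_zero_iff]
    have h1 := norm_sub_norm_le (y n : X) (g n)
    have h2 := hy n
    rw [dist_eq_norm'] at h2
    have h3 := hg n
    change ‖(y n : X)‖ ≤ _
    linarith
  obtain ⟨a, -, ψ, hψ, hlim⟩ := tendsto_subseq_of_bounded Metric.isBounded_closedBall hyb
  obtain ⟨N, hN⟩ := Metric.cauchySeq_iff'.1 hlim.cauchySeq (1 / 2) (by norm_num)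
  have h1 : dist (y (ψ (N + 1)) : X) (y (ψ N)) < 1 / 2 := hN (N + 1) (Nat.le_succ N)
  have h2 := hsep (hψ (Nat.lt_succ_self N)).ne'
  have h3 := dist_triangle4 (g (ψ (N + 1))) (y (ψ (N + 1))) (y (ψ N)) (g (ψ N))
  have h4 := hy (ψ (N + 1))
  have h5 := hy (ψ N)
  rw [dist_comm] at h5
  have h6 : (1 : ℝ) ≤ dist (g (ψ (N + 1))) (g (ψ N)) := by
    rw [dist_eq_norm]
    exact h2
  linarith

/-- The distance from a finite-dimensional subspace is attained by a functional of norm at most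
one that vanishes on the subspace. -/
theorem exists_functional_eq_infDist (F : Submodule 𝕜 X) [FiniteDimensional 𝕜 F] (x : X) :
    ∃ f : X →L[𝕜] 𝕜, ‖f‖ ≤ 1 ∧ (∀ y ∈ F, f y = 0) ∧ f x = (Metric.infDist x F : 𝕜) := by
  have : IsClosed (F : Set X) := F.closed_of_finiteDimensional
  obtain ⟨h, hh, hx⟩ := exists_dual_vector'' 𝕜 (F.mkQ x)
  refine ⟨h.comp F.mkQL, ?_, fun y hy => ?_, ?_⟩
  · refine ContinuousLinearMap.opNorm_le_bound _ zero_le_one fun y => ?_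
    have h1 := h.le_opNorm (F.mkQ y)
    have h2 : ‖F.mkQ y‖ ≤ ‖y‖ := Submodule.Quotient.norm_mk_le F y
    have h3 : ‖h‖ * ‖F.mkQ y‖ ≤ 1 * ‖y‖ := by gcongr
    exact h1.trans h3
  · have : F.mkQ y = 0 := by simpa using hy
    change h (F.mkQ y) = 0
    rw [this, map_zero]
  · change h (F.mkQ x) = _
    rw [hx]
    exact congrArg _ (QuotientAddGroup.norm_mk (S := F.toAddSubgroup) x)

/-- Every infinite-dimensional normed space has a bounded biorthogonal sequence. Each new vector is
taken in the common kernel of the previous functionals, far from the span of the previous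
vectors, so that the new functional can be chosen with norm at most one. -/
theorem exists_bounded_biorthogonal (hX : ¬ FiniteDimensional 𝕜 X) :
    ∃ (e : ℕ → X) (f : ℕ → X →L[𝕜] 𝕜), (∀ n, ‖e n‖ ≤ 12) ∧ (∀ n, ‖f n‖ ≤ 1) ∧
      ∀ i j, f i (e j) = if i = j then 1 else 0 := by
  have hstep : ∀ s : Finset (X × (X →L[𝕜] 𝕜)), ∃ b : X × (X →L[𝕜] 𝕜),
      (‖b.1‖ ≤ 12 ∧ ‖b.2‖ ≤ 1 ∧ b.2 b.1 = 1) ∧ ∀ a ∈ s, a.2 b.1 = 0 ∧ b.2 a.1 = 0 := by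
    intro s
    classical
    set F : Submodule 𝕜 X := Submodule.span 𝕜 (s.image Prod.fst : Finset X)
    obtain ⟨g, hg, hsep⟩ := exists_seq_norm_le_one_le_norm_sub' (c := (2 : 𝕜)) (R := 3)
      (by norm_num) (by norm_num) (not_finiteDimensional_ker_pi hX fun a : s => a.1.2)
    obtain ⟨n, hn⟩ := exists_quarter_le_infDist F (g := fun n => (g n : X)) hg hsep
    obtain ⟨f, hf, hfF, hfg⟩ := exists_functional_eq_infDist F (g n : X)
    set d := Metric.infDist (g n : X) F
    have hd : 0 < d := by linarith
    refine ⟨⟨((d⁻¹ : ℝ) : 𝕜) • (g n : X), f⟩, ⟨?_, hf, ?_⟩, fun a ha => ⟨?_, ?_⟩⟩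
    · rw [norm_smul, RCLike.norm_ofReal, abs_of_pos (inv_pos.2 hd)]
      have h1 : d⁻¹ ≤ 4 := by
        rw [inv_le_comm₀ hd (by norm_num)]
        linarith
      have h2 : ‖(g n : X)‖ ≤ 3 := hg n
      calc d⁻¹ * ‖(g n : X)‖ ≤ 4 * 3 := by gcongr
        _ = 12 := by norm_num
    · rw [map_smul, hfg, smul_eq_mul, ← RCLike.ofReal_mul, inv_mul_cancel₀ hd.ne',
        RCLike.ofReal_one]
    · have h1 : a.2 (g n : X) = 0 := congrFun (LinearMap.mem_ker.1 (g n).2) ⟨a, ha⟩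
      simp [h1]
    · exact hfF _ (Submodule.subset_span (by simpa using ⟨a.2, ha⟩))
  obtain ⟨b, hb, hr⟩ := exists_seq_of_forall_finset_exists _ _ fun s _ => hstep s
  refine ⟨fun n => (b n).1, fun n => (b n).2, fun n => (hb n).1, fun n => (hb n).2.1,
    fun i j => ?_⟩
  rcases lt_trichotomy i j with h | rfl | h
  · rw [if_neg h.ne, (hr i j h).1]
  · rw [if_pos rfl, (hb i).2.2]
  · rw [if_neg h.ne', (hr j i h).2]

end Biorthogonal

/-! ### Fast recurrent approximation in the unit ball -/

section Approximation

/-- A sequence in the closed unit ball that approximates each point of the ball infinitely often,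
with an error much smaller than the inverse of a sequence `Q` tending to infinity: list one after
the other finite `4⁻ʲ`-nets of the ball, and let `Q` be `2ʲ` along the `j`-th net. -/
theorem exists_seq_frequently_mul_norm_sub_lt (𝕜 : Type*) [RCLike 𝕜] :
    ∃ (s : ℕ → 𝕜) (Q : ℕ → ℝ), (∀ k, ‖s k‖ ≤ 1) ∧ (∀ k, 0 ≤ Q k) ∧ Tendsto Q atTop atTop ∧
      ∀ z : 𝕜, ‖z‖ ≤ 1 → ∀ ε > 0, ∃ᶠ k in atTop, Q k * ‖z - s k‖ < ε := by
  have hnet : ∀ j : ℕ, ∃ t ⊆ Metric.closedBall (0 : 𝕜) 1, t.Finite ∧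
      Metric.closedBall (0 : 𝕜) 1 ⊆ ⋃ x ∈ t, Metric.ball x ((1 / 4) ^ j) := fun j =>
    (isCompact_closedBall (0 : 𝕜) 1).finite_cover_balls (by positivity)
  choose T hT hfin hcov using hnet
  have hapx : ∀ z : 𝕜, ‖z‖ ≤ 1 → ∀ j, ∃ y : T j, ‖z - y‖ < (1 / 4) ^ j := fun z hz j => by
    obtain ⟨y, hy, hzy⟩ := Set.mem_iUnion₂.1 (hcov j (mem_closedBall_zero_iff.2 hz))
    exact ⟨⟨y, hy⟩, by rwa [← dist_eq_norm]⟩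
  have : ∀ j, Finite (T j) := fun j => (hfin j).to_subtype
  have hne : ∀ j, Nonempty (T j) := fun j => (hapx 0 (by simp) j).nonempty
  have : Infinite (Σ j, T j) :=
    Infinite.of_surjective (Sigma.fst) fun j => ⟨⟨j, Classical.arbitrary _⟩, rfl⟩
  obtain ⟨hden⟩ := nonempty_denumerable (Σ j, T j)
  let E : ℕ ≃ Σ j, T j := (Denumerable.eqv _).symm
  have hlevel : Tendsto (fun k => (E k).1) atTop atTop := by
    refine tendsto_atTop.2 fun N => ?_
    rw [← Nat.cofinite_eq_atTop]
    refine Set.Finite.preimage E.injective.injOn (s := {a | ¬ N ≤ a.1}) ?_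
    refine (Set.finite_range fun a : Σ j : Fin N, T j => (⟨a.1, a.2⟩ : Σ j, T j)).subset ?_
    exact fun a h => ⟨⟨⟨a.1, not_le.1 h⟩, a.2⟩, rfl⟩
  refine ⟨fun k => ((E k).2 : 𝕜), fun k => 2 ^ (E k).1, fun k => ?_, fun k => by positivity,
    (tendsto_pow_atTop_atTop_of_one_lt one_lt_two).comp hlevel, fun z hz ε hε => ?_⟩
  · exact mem_closedBall_zero_iff.1 (hT _ (E k).2.2)
  · choose y hy using hapx z hz
    have hinj : Function.Injective fun j => E.symm ⟨j, y j⟩ := fun i j h =>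
      congrArg Sigma.fst (E.symm.injective h)
    have hsmall : ∀ᶠ j : ℕ in atTop, ((1 : ℝ) / 2) ^ j < ε :=
      (tendsto_pow_atTop_nhds_zero_of_lt_one (by norm_num) (by norm_num)).eventually_lt_const hε
    refine Tendsto.frequently (p := fun k => 2 ^ (E k).1 * ‖z - ((E k).2 : 𝕜)‖ < ε)
      hinj.nat_tendsto_atTop (Eventually.frequently (hsmall.mono fun j hj => ?_))
    rw [Equiv.apply_symm_apply]
    calc (2 : ℝ) ^ j * ‖z - y j‖ ≤ 2 ^ j * (1 / 4) ^ j := by gcongr; exact (hy j).le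
      _ = (1 / 2) ^ j := by rw [← mul_pow]; norm_num
      _ < ε := hj

end Approximation

/-! ### Nuclear operators -/

section Nuclear

variable {𝕜 : Type*} [RCLike 𝕜] {X : Type*} [NormedAddCommGroup X] [NormedSpace 𝕜 X]

theorem IsNuclearOperator.add {S T : X →L[𝕜] X} (hS : IsNuclearOperator S)
    (hT : IsNuclearOperator T) : IsNuclearOperator (S + T) := by
  obtain ⟨φ, v, hφ, hS⟩ := hS
  obtain ⟨ψ, w, hψ, hT⟩ := hT
  let E := Equiv.natSumNatEquivNat
  refine ⟨fun k => Sum.elim φ ψ (E.symm k), fun k => Sum.elim v w (E.symm k), ?_, ?_⟩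
  · rw [← E.summable_iff]
    refine Summable.sum _ ?_ ?_
    · simpa [Function.comp_def] using hφ
    · simpa [Function.comp_def] using hψ
  · rw [← E.hasSum_iff]
    refine HasSum.sum ?_ ?_
    · simpa [Function.comp_def] using hS
    · simpa [Function.comp_def] using hT

theorem IsNuclearOperator.isCompactOperator [CompleteSpace X] {S : X →L[𝕜] X}
    (hS : IsNuclearOperator S) : IsCompactOperator S := by
  obtain ⟨φ, v, -, hS⟩ := hS
  refine isCompactOperator_of_tendsto hS (Eventually.of_forall fun s => ?_)
  have hrank : ∀ k, (φ k).smulRight (v k) ∈ compactOperator (RingHom.id 𝕜) X X := fun k =>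
    IsCompactOperator.clm_comp (isCompactOperator_of_locallyCompactSpace_dom (φ k))
      (ContinuousLinearMap.toSpanSingleton 𝕜 (v k))
  exact Submodule.sum_mem _ fun k _ => hrank k

end Nuclear

/-! ### Sums of sines and cosines -/

section TrigSums

/-- `∑_{i < t} cos (i θ)`, the real part of `∑_{i < t} exp (i θ √-1)`. -/
noncomputable def cosSum (θ : ℝ) (t : ℕ) : ℝ := ∑ i ∈ Finset.range t, Real.cos (i * θ)

/-- `∑_{i < t} sin (i θ)`, the imaginary part of `∑_{i < t} exp (i θ √-1)`. -/
noncomputable def sinSum (θ : ℝ) (t : ℕ) : ℝ := ∑ i ∈ Finset.range t, Real.sin (i * θ)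

theorem cosSum_one (θ : ℝ) : cosSum θ 1 = 1 := by simp [cosSum]

theorem sinSum_one (θ : ℝ) : sinSum θ 1 = 0 := by simp [sinSum]

theorem abs_cosSum_le (θ : ℝ) (t : ℕ) : |cosSum θ t| ≤ t := by
  refine (Finset.abs_sum_le_sum_abs _ _).trans ?_
  simpa using Finset.sum_le_sum fun i (_ : i ∈ Finset.range t) => Real.abs_cos_le_one (i * θ)

theorem abs_sinSum_le (θ : ℝ) (t : ℕ) : |sinSum θ t| ≤ t := by
  refine (Finset.abs_sum_le_sum_abs _ _).trans ?_
  simpa using Finset.sum_le_sum fun i (_ : i ∈ Finset.range t) => Real.abs_sin_le_one (i * θ)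

/-- Real part of the rule `∑_{i < t + 1} ζ ^ i = ζ * ∑_{i < t} ζ ^ i + 1`. -/
theorem cosSum_succ (θ : ℝ) (t : ℕ) :
    cosSum θ (t + 1) = Real.cos θ * cosSum θ t - Real.sin θ * sinSum θ t + 1 := by
  rw [cosSum, Finset.sum_range_succ', cosSum, sinSum, Finset.mul_sum, Finset.mul_sum,
    ← Finset.sum_sub_distrib]
  simp only [Nat.cast_zero, zero_mul, Real.cos_zero]
  congr 1
  refine Finset.sum_congr rfl fun i _ => ?_
  rw [Nat.cast_add_one, add_mul, one_mul, Real.cos_add]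
  ring

/-- Imaginary part of the rule `∑_{i < t + 1} ζ ^ i = ζ * ∑_{i < t} ζ ^ i + 1`. -/
theorem sinSum_succ (θ : ℝ) (t : ℕ) :
    sinSum θ (t + 1) = Real.sin θ * cosSum θ t + Real.cos θ * sinSum θ t := by
  rw [sinSum, Finset.sum_range_succ', cosSum, sinSum, Finset.mul_sum, Finset.mul_sum,
    ← Finset.sum_add_distrib]
  simp only [Nat.cast_zero, zero_mul, Real.sin_zero, add_zero]
  refine Finset.sum_congr rfl fun i _ => ?_
  rw [Nat.cast_add_one, add_mul, one_mul, Real.sin_add]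
  ring

/-- The geometric sum of a root of unity other than `1` over a multiple of its order vanishes. -/
theorem cosSum_eq_zero_and_sinSum_eq_zero {θ : ℝ} {t : ℕ} (hθ : Real.cos θ ≠ 1)
    (hc : Real.cos (t * θ) = 1) (hs : Real.sin (t * θ) = 0) :
    cosSum θ t = 0 ∧ sinSum θ t = 0 := by
  have h1 : cosSum θ (t + 1) = cosSum θ t + 1 := by
    rw [cosSum, Finset.sum_range_succ, hc, cosSum]
  have h2 : sinSum θ (t + 1) = sinSum θ t := by
    rw [sinSum, Finset.sum_range_succ, hs, sinSum, add_zero]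
  rw [cosSum_succ] at h1
  rw [sinSum_succ] at h2
  have h3 := Real.sin_sq_add_cos_sq θ
  have h4 : 2 * (1 - Real.cos θ) ≠ 0 := mul_ne_zero two_ne_zero (sub_ne_zero.2 hθ.symm)
  constructor
  · refine (mul_eq_zero.1 ?_).resolve_left h4
    linear_combination cosSum θ t * (-h3) - (1 - Real.cos θ) * h1 + Real.sin θ * h2
  · refine (mul_eq_zero.1 ?_).resolve_left h4
    linear_combination sinSum θ t * (-h3) - (1 - Real.cos θ) * h2 - Real.sin θ * h1

/-- During the first sixth of a period the terms of the sum have cosine at least `1 / 2`. -/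
theorem half_le_cosSum {θ : ℝ} {t : ℕ} (hθ : 0 ≤ θ) (ht : t * θ ≤ Real.pi / 3) :
    (t : ℝ) / 2 ≤ cosSum θ t := by
  have h : ∀ i ∈ Finset.range t, (1 / 2 : ℝ) ≤ Real.cos (i * θ) := fun i hi => by
    rw [← Real.cos_pi_div_three]
    have hit : (i : ℝ) * θ ≤ t * θ := by
      have := (Finset.mem_range.1 hi).le
      gcongr
    exact Real.cos_le_cos_of_nonneg_of_le_pi (by positivity) (by linarith [Real.pi_pos])
      (hit.trans ht)
  have := Finset.sum_le_sum h
  rw [Finset.sum_const, Finset.card_range, nsmul_eq_mul] at this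
  rw [cosSum]
  linarith

end TrigSums

/-! ### The construction data -/

/-- The data of the construction: a bounded biorthogonal sequence `(e, f)`, points `s n` of the
unit ball of `𝕜`, and gains `Q n ≥ 0`. -/
structure SpiralData (𝕜 X : Type*) [RCLike 𝕜] [NormedAddCommGroup X] [NormedSpace 𝕜 X] where
  e : ℕ → X
  f : ℕ → X →L[𝕜] 𝕜
  s : ℕ → 𝕜
  Q : ℕ → ℝ
  norm_e_le : ∀ n, ‖e n‖ ≤ 12
  norm_f_le : ∀ n, ‖f n‖ ≤ 1
  f_e : ∀ i j, f i (e j) = if i = j then 1 else 0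
  norm_s_le : ∀ n, ‖s n‖ ≤ 1
  Q_nonneg : ∀ n, 0 ≤ Q n

namespace SpiralData

variable {𝕜 : Type*} [RCLike 𝕜] {X : Type*} [NormedAddCommGroup X] [NormedSpace 𝕜 X]
variable (D : SpiralData 𝕜 X)

/-! ### Periods, angles and weights -/

section Parameters

/-- The times at which orbits may return: the rotation of the `n`-th plane has order
`D.period (n + 1)`. Each divides the next and the ratios grow fast. -/
noncomputable def period (n : ℕ) : ℕ := ∏ i ∈ Finset.range (n + 1), ⌈4 ^ i * (1 + D.Q i)⌉₊

/-- The angle of the rotation of the `n`-th plane. -/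
noncomputable def angle (n : ℕ) : ℝ := 2 * Real.pi / D.period (n + 1)

/-- The size of the push given to the `n`-th plane. -/
noncomputable def weight (n : ℕ) : ℝ := D.Q n / D.period n

theorem one_le_factor (i : ℕ) : 1 ≤ ⌈4 ^ i * (1 + D.Q i)⌉₊ := by
  have := D.Q_nonneg i
  exact Nat.one_le_iff_ne_zero.2 (Nat.ceil_pos.2 (by positivity)).ne'

theorem period_pos (n : ℕ) : 0 < D.period n :=
  Finset.prod_pos fun i _ => D.one_le_factor i

theorem period_dvd {i j : ℕ} (h : i ≤ j) : D.period i ∣ D.period j :=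
  Finset.prod_dvd_prod_of_subset _ _ _ (Finset.range_subset_range.2 (by lia))

theorem period_le {i j : ℕ} (h : i ≤ j) : D.period i ≤ D.period j :=
  Nat.le_of_dvd (D.period_pos j) (D.period_dvd h)

theorem period_mul_le {i j : ℕ} (h : i < j) :
    D.period i * (4 ^ j * (1 + D.Q j)) ≤ (D.period j : ℝ) := by
  obtain ⟨j, rfl⟩ : ∃ k, j = k + 1 := ⟨j - 1, by lia⟩
  have h1 : D.period (j + 1) = D.period j * ⌈4 ^ (j + 1) * (1 + D.Q (j + 1))⌉₊ :=
    Finset.prod_range_succ _ _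
  have h2 : (D.period i : ℝ) ≤ D.period j := by exact_mod_cast D.period_le (by lia)
  have h3 := D.Q_nonneg (j + 1)
  rw [h1, Nat.cast_mul]
  gcongr
  exact Nat.le_ceil _

theorem factor_le_period (n : ℕ) : 4 ^ n * (1 + D.Q n) ≤ (D.period n : ℝ) := by
  refine (Nat.le_ceil _).trans ?_
  exact_mod_cast Nat.le_of_dvd (D.period_pos n)
    (Finset.dvd_prod_of_mem (fun i => ⌈4 ^ i * (1 + D.Q i)⌉₊) (Finset.self_mem_range_succ n))

theorem angle_pos (n : ℕ) : 0 < D.angle n :=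
  div_pos (by positivity) (by exact_mod_cast D.period_pos (n + 1))

theorem weight_nonneg (n : ℕ) : 0 ≤ D.weight n := div_nonneg (D.Q_nonneg n) (by positivity)

theorem weight_mul_period (n : ℕ) : D.weight n * D.period n = D.Q n :=
  div_mul_cancel₀ _ (by exact_mod_cast (D.period_pos n).ne')

theorem weight_mul_period_le {k n : ℕ} (h : k < n) : D.weight n * D.period k ≤ (1 / 4) ^ n := by
  have h1 : (0 : ℝ) < D.period n := by exact_mod_cast D.period_pos n
  have h2 := D.period_mul_le h
  rw [weight, div_mul_eq_mul_div, div_le_iff₀ h1, one_div_pow, one_div, ← div_eq_inv_mul,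
    le_div_iff₀ (by positivity)]
  have h3 : (0 : ℝ) ≤ D.period k * 4 ^ n := by positivity
  nlinarith

theorem weight_le (n : ℕ) : D.weight n ≤ (1 / 4) ^ n := by
  have h1 : (0 : ℝ) < D.period n := by exact_mod_cast D.period_pos n
  have h2 := D.factor_le_period n
  rw [weight, div_le_iff₀ h1, one_div_pow, one_div, ← div_eq_inv_mul,
    le_div_iff₀ (by positivity)]
  have h3 : (0 : ℝ) ≤ 4 ^ n := by positivity
  nlinarith

theorem period_mul_angle_le {k n : ℕ} (h : k ≤ n) :
    D.period k * D.angle n ≤ 2 * (1 / 4) ^ n := by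
  have h1 : (0 : ℝ) < D.period (n + 1) := by exact_mod_cast D.period_pos (n + 1)
  have h2 := D.period_mul_le (Nat.lt_succ_of_le h)
  have h3 := Real.pi_le_four
  have h4 : (0 : ℝ) ≤ D.period k * 4 ^ n := by positivity
  rw [angle, mul_div_assoc', div_le_iff₀ h1, one_div_pow, mul_one_div, ← mul_div_right_comm,
    le_div_iff₀ (by positivity)]
  have h5 : (D.period k : ℝ) * 4 ^ (n + 1) ≤ D.period (n + 1) := by
    refine le_trans ?_ h2
    have := D.Q_nonneg (n + 1)
    gcongr
    exact le_mul_of_one_le_right (by positivity) (by linarith)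
  rw [pow_succ] at h5
  nlinarith

theorem angle_le (n : ℕ) : D.angle n ≤ 2 * (1 / 4) ^ n := by
  refine le_trans ?_ (D.period_mul_angle_le (Nat.zero_le n))
  exact le_mul_of_one_le_left (D.angle_pos n).le (by exact_mod_cast D.period_pos 0)

theorem cos_angle_ne_one (n : ℕ) : Real.cos (D.angle n) ≠ 1 := by
  have h1 : (4 : ℝ) ≤ D.period (n + 1) := by
    refine le_trans ?_ (D.factor_le_period (n + 1))
    have h2 : (1 : ℝ) ≤ 4 ^ n := one_le_pow₀ (by norm_num)
    have h3 := D.Q_nonneg (n + 1)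
    rw [pow_succ]
    nlinarith [mul_nonneg (zero_le_one.trans h2) h3]
  have h2 : D.angle n ≤ Real.pi / 2 := by
    rw [angle, div_le_iff₀ (by linarith)]
    nlinarith [Real.pi_pos]
  have h3 := Real.cos_lt_cos_of_nonneg_of_le_pi_div_two le_rfl h2 (D.angle_pos n)
  rw [Real.cos_zero] at h3
  exact h3.ne

theorem exists_mul_angle_eq {n t : ℕ} (h : D.period (n + 1) ∣ t) :
    ∃ j : ℕ, t * D.angle n = j * (2 * Real.pi) := by
  obtain ⟨j, rfl⟩ := h
  have : (D.period (n + 1) : ℝ) ≠ 0 := by exact_mod_cast (D.period_pos (n + 1)).ne'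
  refine ⟨j, ?_⟩
  rw [angle, Nat.cast_mul]
  field_simp

end Parameters

/-! ### The displacement in each plane -/

section Blocks

/-- The first vector of the `n`-th plane. -/
def u (n : ℕ) : X := D.e (2 * n + 2)

/-- The second vector of the `n`-th plane. -/
def v (n : ℕ) : X := D.e (2 * n + 3)

/-- The coordinate along `D.u n`. -/
def p (n : ℕ) : X →L[𝕜] 𝕜 := D.f (2 * n + 2)

/-- The coordinate along `D.v n`. -/
def q (n : ℕ) : X →L[𝕜] 𝕜 := D.f (2 * n + 3)

/-- The functional that drives the `n`-th plane. -/
noncomputable def driver (n : ℕ) : X →L[𝕜] 𝕜 := D.f 0 + D.s n • D.f 1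

/-- The coordinate along `D.u n` of the displacement of a vector after `t` steps. -/
noncomputable def uCoeff (n t : ℕ) : X →L[𝕜] 𝕜 :=
  ((Real.cos (t * D.angle n) - 1 : ℝ) : 𝕜) • D.p n - (Real.sin (t * D.angle n) : 𝕜) • D.q n +
    ((D.weight n * cosSum (D.angle n) t : ℝ) : 𝕜) • D.driver n

/-- The coordinate along `D.v n` of the displacement of a vector after `t` steps. -/
noncomputable def vCoeff (n t : ℕ) : X →L[𝕜] 𝕜 :=
  (Real.sin (t * D.angle n) : 𝕜) • D.p n + ((Real.cos (t * D.angle n) - 1 : ℝ) : 𝕜) • D.q n +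
    ((D.weight n * sinSum (D.angle n) t : ℝ) : 𝕜) • D.driver n

/-- The displacement of a vector after `t` steps within the `n`-th plane. -/
noncomputable def block (n t : ℕ) : X →L[𝕜] X :=
  (D.uCoeff n t).smulRight (D.u n) + (D.vCoeff n t).smulRight (D.v n)

theorem norm_f_apply_le (n : ℕ) (x : X) : ‖D.f n x‖ ≤ ‖x‖ :=
  (D.f n).le_of_opNorm_le (D.norm_f_le n) x |>.trans_eq (one_mul _)

theorem driver_apply (n : ℕ) (x : X) : D.driver n x = D.f 0 x + D.s n * D.f 1 x := rfl

theorem norm_driver_apply_le (n : ℕ) (x : X) : ‖D.driver n x‖ ≤ 2 * ‖x‖ := by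
  rw [driver_apply]
  refine (norm_add_le _ _).trans ?_
  rw [norm_mul]
  have h1 := D.norm_f_apply_le 0 x
  have h2 : ‖D.s n‖ * ‖D.f 1 x‖ ≤ 1 * ‖x‖ := by
    gcongr
    exacts [D.norm_s_le n, D.norm_f_apply_le 1 x]
  linarith

theorem uCoeff_apply (n t : ℕ) (x : X) : D.uCoeff n t x =
    ((Real.cos (t * D.angle n) - 1 : ℝ) : 𝕜) * D.p n x - (Real.sin (t * D.angle n) : 𝕜) * D.q n x +
      ((D.weight n * cosSum (D.angle n) t : ℝ) : 𝕜) * D.driver n x := rfl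

theorem vCoeff_apply (n t : ℕ) (x : X) : D.vCoeff n t x =
    (Real.sin (t * D.angle n) : 𝕜) * D.p n x + ((Real.cos (t * D.angle n) - 1 : ℝ) : 𝕜) * D.q n x +
      ((D.weight n * sinSum (D.angle n) t : ℝ) : 𝕜) * D.driver n x := rfl

theorem block_apply (n t : ℕ) (x : X) :
    D.block n t x = D.uCoeff n t x • D.u n + D.vCoeff n t x • D.v n := rfl

theorem abs_cos_sub_one_le (y : ℝ) : |Real.cos y - 1| ≤ |y| := by
  simpa using Real.abs_cos_sub_cos_le y 0

theorem norm_uCoeff_apply_le (n t : ℕ) (x : X) : ‖D.uCoeff n t x‖ ≤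
    2 * (t * D.angle n) * ‖x‖ + D.weight n * t * ‖D.driver n x‖ := by
  have h0 : 0 ≤ t * D.angle n := mul_nonneg (Nat.cast_nonneg t) (D.angle_pos n).le
  have h1 := abs_cos_sub_one_le (t * D.angle n)
  have h2 := Real.abs_sin_le_abs (x := t * D.angle n)
  rw [abs_of_nonneg h0] at h1 h2
  have hp := D.norm_f_apply_le (2 * n + 2) x
  have hq := D.norm_f_apply_le (2 * n + 3) x
  have hw := D.weight_nonneg n
  have hc := abs_cosSum_le (D.angle n) t
  rw [uCoeff_apply]
  refine (norm_add_le _ _).trans (add_le_add ((norm_sub_le _ _).trans ?_) ?_)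
  · rw [norm_mul, norm_mul, RCLike.norm_ofReal, RCLike.norm_ofReal]
    have h3 : |Real.cos (t * D.angle n) - 1| * ‖D.p n x‖ ≤ t * D.angle n * ‖x‖ := by gcongr; exact hp
    have h4 : |Real.sin (t * D.angle n)| * ‖D.q n x‖ ≤ t * D.angle n * ‖x‖ := by gcongr; exact hq
    linarith
  · rw [norm_mul, RCLike.norm_ofReal, abs_mul, abs_of_nonneg hw]
    gcongr

theorem norm_vCoeff_apply_le (n t : ℕ) (x : X) : ‖D.vCoeff n t x‖ ≤
    2 * (t * D.angle n) * ‖x‖ + D.weight n * t * ‖D.driver n x‖ := by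
  have h0 : 0 ≤ t * D.angle n := mul_nonneg (Nat.cast_nonneg t) (D.angle_pos n).le
  have h1 := abs_cos_sub_one_le (t * D.angle n)
  have h2 := Real.abs_sin_le_abs (x := t * D.angle n)
  rw [abs_of_nonneg h0] at h1 h2
  have hp := D.norm_f_apply_le (2 * n + 2) x
  have hq := D.norm_f_apply_le (2 * n + 3) x
  have hw := D.weight_nonneg n
  have hc := abs_sinSum_le (D.angle n) t
  rw [vCoeff_apply]
  refine (norm_add_le _ _).trans (add_le_add ((norm_add_le _ _).trans ?_) ?_)
  · rw [norm_mul, norm_mul, RCLike.norm_ofReal, RCLike.norm_ofReal]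
    have h3 : |Real.sin (t * D.angle n)| * ‖D.p n x‖ ≤ t * D.angle n * ‖x‖ := by gcongr; exact hp
    have h4 : |Real.cos (t * D.angle n) - 1| * ‖D.q n x‖ ≤ t * D.angle n * ‖x‖ := by gcongr; exact hq
    linarith
  · rw [norm_mul, RCLike.norm_ofReal, abs_mul, abs_of_nonneg hw]
    gcongr

theorem norm_block_apply_le (n t : ℕ) (x : X) : ‖D.block n t x‖ ≤
    24 * (2 * (t * D.angle n) * ‖x‖ + D.weight n * t * ‖D.driver n x‖) := by
  have h1 := D.norm_uCoeff_apply_le n t x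
  have h2 := D.norm_vCoeff_apply_le n t x
  have h3 := D.norm_e_le (2 * n + 2)
  have h4 := D.norm_e_le (2 * n + 3)
  rw [block_apply]
  refine (norm_add_le _ _).trans ?_
  rw [norm_smul, norm_smul]
  set b := 2 * (t * D.angle n) * ‖x‖ + D.weight n * t * ‖D.driver n x‖
  have h0 : 0 ≤ b := (norm_nonneg _).trans h1
  have h5 : ‖D.uCoeff n t x‖ * ‖D.u n‖ ≤ b * 12 := by gcongr; exact h3
  have h6 : ‖D.vCoeff n t x‖ * ‖D.v n‖ ≤ b * 12 := by gcongr; exact h4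
  linarith

/-- After a multiple of its period, every orbit is back where it started in the `n`-th plane. -/
theorem block_eq_zero {n t : ℕ} (h : D.period (n + 1) ∣ t) : D.block n t = 0 := by
  obtain ⟨j, hj⟩ := D.exists_mul_angle_eq h
  have hc : Real.cos (t * D.angle n) = 1 := by rw [hj, Real.cos_nat_mul_two_pi]
  have hs : Real.sin (t * D.angle n) = 0 := by
    rw [hj, show (j : ℝ) * (2 * Real.pi) = ((2 * j : ℕ) : ℝ) * Real.pi by push_cast; ring,
      Real.sin_nat_mul_pi]
  obtain ⟨h1, h2⟩ := cosSum_eq_zero_and_sinSum_eq_zero (D.cos_angle_ne_one n) hc hs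
  ext x
  simp [block_apply, uCoeff_apply, vCoeff_apply, hc, hs, h1, h2]

theorem p_block (n j t : ℕ) (x : X) :
    D.p n (D.block j t x) = if j = n then D.uCoeff n t x else 0 := by
  rw [block_apply, map_add, map_smul, map_smul, p, u, v, D.f_e, D.f_e,
    if_neg (show ¬ 2 * n + 2 = 2 * j + 3 by lia), smul_zero, add_zero]
  by_cases h : j = n
  · subst h
    simp
  · rw [if_neg (by lia), if_neg h, smul_zero]

theorem q_block (n j t : ℕ) (x : X) :
    D.q n (D.block j t x) = if j = n then D.vCoeff n t x else 0 := by
  rw [block_apply, map_add, map_smul, map_smul, q, u, v, D.f_e, D.f_e,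
    if_neg (show ¬ 2 * n + 3 = 2 * j + 2 by lia), smul_zero, zero_add]
  by_cases h : j = n
  · subst h
    simp
  · rw [if_neg (by lia), if_neg h, smul_zero]

theorem driver_block (n j t : ℕ) (x : X) : D.driver n (D.block j t x) = 0 := by
  simp [driver_apply, block_apply, u, v, D.f_e]

/-- Composition of rotations: one more step moves the first coordinate as prescribed. -/
theorem uCoeff_succ {n t : ℕ} {x y : X} (hp : D.p n y = D.p n x + D.uCoeff n t x)
    (hq : D.q n y = D.q n x + D.vCoeff n t x) (hd : D.driver n y = D.driver n x) :
    D.uCoeff n (t + 1) x = D.uCoeff n t x + D.uCoeff n 1 y := by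
  rw [D.uCoeff_apply n 1, hp, hq, hd, uCoeff_apply, uCoeff_apply, vCoeff_apply, cosSum_succ,
    cosSum_one, Nat.cast_add_one, add_mul, one_mul, Real.cos_add, Real.sin_add, Nat.cast_one,
    one_mul]
  push_cast
  ring

/-- Composition of rotations: one more step moves the second coordinate as prescribed. -/
theorem vCoeff_succ {n t : ℕ} {x y : X} (hp : D.p n y = D.p n x + D.uCoeff n t x)
    (hq : D.q n y = D.q n x + D.vCoeff n t x) (hd : D.driver n y = D.driver n x) :
    D.vCoeff n (t + 1) x = D.vCoeff n t x + D.vCoeff n 1 y := by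
  rw [D.vCoeff_apply n 1, hp, hq, hd, vCoeff_apply, uCoeff_apply, vCoeff_apply, sinSum_succ,
    sinSum_one, Nat.cast_add_one, add_mul, one_mul, Real.sin_add, Real.cos_add, Nat.cast_one,
    one_mul]
  push_cast
  ring

theorem p_eq_of_hasSum {t : ℕ} {x z : X} (h : HasSum (fun n => D.block n t x) z) (n : ℕ) :
    D.p n z = D.uCoeff n t x := by
  have h1 := h.mapL (D.p n)
  simp only [p_block] at h1
  exact h1.unique (hasSum_ite_eq n _)

theorem q_eq_of_hasSum {t : ℕ} {x z : X} (h : HasSum (fun n => D.block n t x) z) (n : ℕ) :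
    D.q n z = D.vCoeff n t x := by
  have h1 := h.mapL (D.q n)
  simp only [q_block] at h1
  exact h1.unique (hasSum_ite_eq n _)

theorem driver_eq_of_hasSum {t : ℕ} {x z : X} (h : HasSum (fun n => D.block n t x) z) (n : ℕ) :
    D.driver n z = 0 := by
  have h1 := h.mapL (D.driver n)
  simp only [driver_block] at h1
  exact h1.unique hasSum_zero

end Blocks

/-! ### The operator and its powers -/

section Operator

/-- The operator `K`: in each plane it performs one step of the rotation minus the identity,
plus the push by the driving functional. -/
noncomputable def perturbation : X →L[𝕜] X :=
  (∑' n, (D.uCoeff n 1).smulRight (D.u n)) + ∑' n, (D.vCoeff n 1).smulRight (D.v n)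

/-- The operator `R = I + K`. -/
noncomputable def operator : X →L[𝕜] X := ContinuousLinearMap.id 𝕜 X + D.perturbation

theorem step_bound_le (n : ℕ) (x : X) :
    2 * ((1 : ℕ) * D.angle n) * ‖x‖ + D.weight n * (1 : ℕ) * ‖D.driver n x‖ ≤
      6 * (1 / 4) ^ n * ‖x‖ := by
  have h1 := D.angle_le n
  have h2 := D.weight_le n
  have h3 := D.norm_driver_apply_le n x
  have h4 : D.angle n * ‖x‖ ≤ 2 * (1 / 4) ^ n * ‖x‖ := by gcongr
  have h5 : D.weight n * ‖D.driver n x‖ ≤ (1 / 4) ^ n * (2 * ‖x‖) := by gcongr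
  rw [Nat.cast_one, one_mul, mul_one]
  linarith

theorem norm_uCoeff_one_le (n : ℕ) : ‖D.uCoeff n 1‖ ≤ 6 * (1 / 4) ^ n :=
  ContinuousLinearMap.opNorm_le_bound _ (by positivity) fun x =>
    (D.norm_uCoeff_apply_le n 1 x).trans (D.step_bound_le n x)

theorem norm_vCoeff_one_le (n : ℕ) : ‖D.vCoeff n 1‖ ≤ 6 * (1 / 4) ^ n :=
  ContinuousLinearMap.opNorm_le_bound _ (by positivity) fun x =>
    (D.norm_vCoeff_apply_le n 1 x).trans (D.step_bound_le n x)

theorem summable_uCoeff : Summable fun n => ‖D.uCoeff n 1‖ * ‖D.u n‖ := by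
  have hg : Summable fun n : ℕ => 6 * (1 / 4 : ℝ) ^ n * 12 :=
    ((summable_geometric_of_lt_one (by norm_num) (by norm_num)).mul_left 6).mul_right 12
  refine hg.of_nonneg_of_le (fun n => by positivity) fun n => ?_
  gcongr
  exacts [D.norm_uCoeff_one_le n, D.norm_e_le _]

theorem summable_vCoeff : Summable fun n => ‖D.vCoeff n 1‖ * ‖D.v n‖ := by
  have hg : Summable fun n : ℕ => 6 * (1 / 4 : ℝ) ^ n * 12 :=
    ((summable_geometric_of_lt_one (by norm_num) (by norm_num)).mul_left 6).mul_right 12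
  refine hg.of_nonneg_of_le (fun n => by positivity) fun n => ?_
  gcongr
  exacts [D.norm_vCoeff_one_le n, D.norm_e_le _]

variable [CompleteSpace X]

theorem hasSum_uCoeff : HasSum (fun n => (D.uCoeff n 1).smulRight (D.u n))
    (∑' n, (D.uCoeff n 1).smulRight (D.u n)) := by
  refine (Summable.of_norm ?_).hasSum
  simpa only [ContinuousLinearMap.norm_smulRight_apply] using D.summable_uCoeff

theorem hasSum_vCoeff : HasSum (fun n => (D.vCoeff n 1).smulRight (D.v n))
    (∑' n, (D.vCoeff n 1).smulRight (D.v n)) := by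
  refine (Summable.of_norm ?_).hasSum
  simpa only [ContinuousLinearMap.norm_smulRight_apply] using D.summable_vCoeff

theorem isNuclearOperator_perturbation : IsNuclearOperator D.perturbation :=
  IsNuclearOperator.add ⟨_, _, D.summable_uCoeff, D.hasSum_uCoeff⟩
    ⟨_, _, D.summable_vCoeff, D.hasSum_vCoeff⟩

theorem hasSum_block_one (x : X) : HasSum (fun n => D.block n 1 x) (D.perturbation x) :=
  (D.hasSum_uCoeff.add D.hasSum_vCoeff).mapL (ContinuousLinearMap.apply 𝕜 X x)

/-- The displacement of a vector after `t` steps is the sum of its displacements in the planes. -/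
theorem hasSum_block (t : ℕ) (x : X) :
    HasSum (fun n => D.block n t x) ((D.operator ^ t) x - x) := by
  induction t with
  | zero => simp [D.block_eq_zero (dvd_zero _)]
  | succ t ih =>
    have hx : x + ((D.operator ^ t) x - x) = (D.operator ^ t) x := add_sub_cancel _ _
    have hp n : D.p n ((D.operator ^ t) x) = D.p n x + D.uCoeff n t x := by
      rw [← D.p_eq_of_hasSum ih n, ← map_add, hx]
    have hq n : D.q n ((D.operator ^ t) x) = D.q n x + D.vCoeff n t x := by
      rw [← D.q_eq_of_hasSum ih n, ← map_add, hx]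
    have hd n : D.driver n ((D.operator ^ t) x) = D.driver n x := by
      conv_lhs => rw [← hx, map_add, D.driver_eq_of_hasSum ih n, add_zero]
    have hsum := ih.add (D.hasSum_block_one ((D.operator ^ t) x))
    have h1 : (D.operator ^ (t + 1)) x - x =
        (D.operator ^ t) x - x + D.perturbation ((D.operator ^ t) x) := by
      rw [pow_succ']
      change (D.operator ^ t) x + D.perturbation ((D.operator ^ t) x) - x = _
      abel
    rw [h1]
    convert hsum using 2 with n
    rw [block_apply, block_apply, block_apply, D.uCoeff_succ (hp n) (hq n) (hd n),
      D.vCoeff_succ (hp n) (hq n) (hd n), add_smul, add_smul]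
    abel

end Operator

end SpiralData

/-! ### Orbits tending to infinity and recurrent vectors -/

section Orbits

variable {𝕜 : Type*} [RCLike 𝕜] {X : Type*} [NormedAddCommGroup X] [NormedSpace 𝕜 X]

theorem disjoint_orbitsToInfinity_recurrentVectors (R : X →L[𝕜] X) :
    Disjoint (orbitsToInfinity R) (recurrentVectors R) := by
  refine Set.disjoint_left.2 fun x hA hB => ?_
  have h1 : ∀ᶠ t : ℕ in atTop, (1 : ℝ≥0∞) ≤ ‖(R ^ t) x - x‖ₑ := by
    filter_upwards [(hA : Tendsto _ _ _).eventually_ge_atTop (1 + ‖x‖)] with t ht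
    have h2 := norm_sub_norm_le ((R ^ t) x) x
    rw [← ofReal_norm]
    exact ENNReal.one_le_ofReal.2 (by linarith)
  have h2 := le_liminf_of_le (by isBoundedDefault) h1
  rw [show liminf (fun t : ℕ => ‖(R ^ t) x - x‖ₑ) atTop = 0 from hB] at h2
  exact absurd h2 (by simp)

theorem mem_recurrentVectors_of_frequently {R : X →L[𝕜] X} {x : X}
    (h : ∀ ε > 0, ∃ᶠ t : ℕ in atTop, ‖(R ^ t) x - x‖ < ε) : x ∈ recurrentVectors R := by
  refine le_antisymm (ENNReal.le_of_forall_pos_le_add fun ε hε _ => ?_) bot_le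
  rw [zero_add]
  refine liminf_le_of_frequently_le' ((h ε (by exact_mod_cast hε)).mono fun t ht => ?_)
  rw [← ofReal_norm]
  exact (ENNReal.ofReal_le_ofReal ht.le).trans_eq ENNReal.ofReal_coe_nnreal

end Orbits

/-! ### The dichotomy for the orbits of the operator -/

namespace SpiralData

variable {𝕜 : Type*} [RCLike 𝕜] {X : Type*} [NormedAddCommGroup X] [NormedSpace 𝕜 X]
variable (D : SpiralData 𝕜 X)

theorem tendsto_period : Tendsto D.period atTop atTop := by
  refine tendsto_atTop_mono (fun n => ?_) tendsto_id
  have h1 : (4 : ℝ) ^ n ≤ D.period n :=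
    (le_mul_of_one_le_right (by positivity) (by linarith [D.Q_nonneg n])).trans
      (D.factor_le_period n)
  have h2 : 4 ^ n ≤ D.period n := by exact_mod_cast h1
  exact (Nat.lt_pow_self (by norm_num)).le.trans h2

theorem exists_period_le_six_mul {N t : ℕ} (h : D.period N ≤ t) :
    ∃ n ≥ N, D.period n ≤ 6 * t ∧ 6 * t < D.period (n + 1) := by
  have hex : ∃ n, 6 * t < D.period (n + 1) :=
    ((D.tendsto_period.comp (tendsto_add_atTop_nat 1)).eventually_gt_atTop (6 * t)).exists
  classical
  have hN : N ≤ Nat.find hex := by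
    by_contra! hlt
    have h1 := Nat.find_spec hex
    have h2 := D.period_le (Nat.succ_le_of_lt hlt)
    lia
  refine ⟨Nat.find hex, hN, ?_, Nat.find_spec hex⟩
  rcases Nat.eq_zero_or_pos (Nat.find hex) with h0 | hpos
  · rw [h0] at hN ⊢
    rw [Nat.le_zero.1 hN] at h
    lia
  · have h1 := Nat.find_min hex (Nat.sub_lt hpos one_pos)
    rw [show Nat.find hex - 1 + 1 = Nat.find hex by lia] at h1
    lia

variable [CompleteSpace X]

/-- Up to a sixth of the period of the `n`-th plane, the pushes there have been rotated by at most
`π / 3`, so they do not cancel. If `6 * t` is also at least `D.period n`, they add up to at least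
`D.Q n / 12` times the value of the driving functional. -/
theorem le_norm_operator_pow {n t : ℕ} (h1 : D.period n ≤ 6 * t) (h2 : 6 * t < D.period (n + 1))
    (x : X) : D.Q n / 12 * ‖D.driver n x‖ - 2 * ‖x‖ ≤ ‖(D.operator ^ t) x‖ := by
  have hpx : D.p n ((D.operator ^ t) x) = D.p n x + D.uCoeff n t x := by
    rw [← D.p_eq_of_hasSum (D.hasSum_block t x) n, ← map_add, add_sub_cancel]
  have hc : (t : ℝ) / 2 ≤ cosSum (D.angle n) t := by
    refine half_le_cosSum (D.angle_pos n).le ?_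
    have h3 : (6 * t : ℝ) ≤ D.period (n + 1) := by exact_mod_cast h2.le
    have h4 : (0 : ℝ) < D.period (n + 1) := by exact_mod_cast D.period_pos (n + 1)
    rw [angle, mul_div_assoc', div_le_iff₀ h4]
    nlinarith [Real.pi_pos]
  have hpush : D.Q n / 12 ≤ D.weight n * cosSum (D.angle n) t := by
    have h3 : (D.period n : ℝ) ≤ 6 * t := by exact_mod_cast h1
    calc D.Q n / 12 = D.weight n * (D.period n / 12) := by rw [← D.weight_mul_period n]; ring
      _ ≤ D.weight n * cosSum (D.angle n) t := by
        have := D.weight_nonneg n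
        gcongr
        linarith
  have hw : 0 ≤ D.weight n * cosSum (D.angle n) t :=
    (div_nonneg (D.Q_nonneg n) (by norm_num)).trans hpush
  set c : ℝ := Real.cos (t * D.angle n)
  set r : ℝ := Real.sin (t * D.angle n)
  have heq : ((D.weight n * cosSum (D.angle n) t : ℝ) : 𝕜) * D.driver n x =
      D.p n ((D.operator ^ t) x) - ((c : 𝕜) * D.p n x - (r : 𝕜) * D.q n x) := by
    rw [hpx, uCoeff_apply]
    push_cast
    ring
  have h3 : ‖D.p n ((D.operator ^ t) x)‖ ≤ ‖(D.operator ^ t) x‖ := D.norm_f_apply_le _ _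
  have h4 : ‖(c : 𝕜) * D.p n x‖ ≤ 1 * ‖x‖ := by
    rw [norm_mul, RCLike.norm_ofReal]
    gcongr
    exacts [Real.abs_cos_le_one _, D.norm_f_apply_le _ _]
  have h5 : ‖(r : 𝕜) * D.q n x‖ ≤ 1 * ‖x‖ := by
    rw [norm_mul, RCLike.norm_ofReal]
    gcongr
    exacts [Real.abs_sin_le_one _, D.norm_f_apply_le _ _]
  have h6 := norm_sub_le (D.p n ((D.operator ^ t) x)) ((c : 𝕜) * D.p n x - (r : 𝕜) * D.q n x)
  have h7 := norm_sub_le ((c : 𝕜) * D.p n x) ((r : 𝕜) * D.q n x)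
  rw [← heq, norm_mul, RCLike.norm_ofReal, abs_of_nonneg hw] at h6
  have h8 : D.Q n / 12 * ‖D.driver n x‖ ≤
      D.weight n * cosSum (D.angle n) t * ‖D.driver n x‖ := by gcongr
  linarith

theorem mem_orbitsToInfinity (hQ : Tendsto D.Q atTop atTop) {x : X} (hx : ‖D.f 1 x‖ < ‖D.f 0 x‖) :
    x ∈ orbitsToInfinity D.operator := by
  have hδ : 0 < ‖D.f 0 x‖ - ‖D.f 1 x‖ := sub_pos.2 hx
  have hdriver : ∀ n, ‖D.f 0 x‖ - ‖D.f 1 x‖ ≤ ‖D.driver n x‖ := fun n => by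
    have h1 : ‖D.s n * D.f 1 x‖ ≤ ‖D.f 1 x‖ := by
      rw [norm_mul]
      exact mul_le_of_le_one_left (norm_nonneg _) (D.norm_s_le n)
    have h2 := norm_sub_norm_le (D.f 0 x) (-(D.s n * D.f 1 x))
    rw [norm_neg, sub_neg_eq_add, ← driver_apply] at h2
    linarith
  refine tendsto_atTop.2 fun M => ?_
  obtain ⟨N, hN⟩ := eventually_atTop.1
    (hQ.eventually_ge_atTop (12 * (M + 2 * ‖x‖) / (‖D.f 0 x‖ - ‖D.f 1 x‖)))
  filter_upwards [eventually_ge_atTop (D.period N)] with t ht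
  obtain ⟨n, hn, h1, h2⟩ := D.exists_period_le_six_mul ht
  have h3 := D.le_norm_operator_pow h1 h2 x
  have h4 := (div_le_iff₀ hδ).1 (hN n hn)
  have h5 : D.Q n * (‖D.f 0 x‖ - ‖D.f 1 x‖) ≤ D.Q n * ‖D.driver n x‖ :=
    mul_le_mul_of_nonneg_left (hdriver n) (D.Q_nonneg n)
  linarith

/-- At the time `D.period k`, the planes before the `k`-th are back in place, and only the push in
the `k`-th plane is not automatically small. -/
theorem norm_operator_pow_period_sub_le (k : ℕ) (x : X) :
    ‖(D.operator ^ D.period k) x - x‖ ≤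
      288 * ‖x‖ * (1 / 2) ^ k + 24 * (D.Q k * ‖D.driver k x‖) := by
  have hgeom : HasSum (fun n : ℕ => 144 * ‖x‖ * (1 / 2) ^ k * (1 / 2 : ℝ) ^ n)
      (144 * ‖x‖ * (1 / 2) ^ k * 2) := hasSum_geometric_two.mul_left _
  have hsingle := hasSum_ite_eq k (24 * (D.Q k * ‖D.driver k x‖))
  have hQ : 0 ≤ 24 * (D.Q k * ‖D.driver k x‖) := by
    have := D.Q_nonneg k
    positivity
  refine ((D.hasSum_block (D.period k) x).norm_le_of_bounded (hgeom.add hsingle)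
    fun n => ?_).trans_eq (by ring)
  rcases lt_or_ge n k with hnk | hkn
  · rw [D.block_eq_zero (D.period_dvd hnk), zero_apply, norm_zero]
    exact add_nonneg (by positivity) (by split_ifs <;> simp [hQ])
  · refine (D.norm_block_apply_le n (D.period k) x).trans ?_
    have h1 : D.period k * D.angle n * ‖x‖ ≤ 2 * (1 / 4) ^ n * ‖x‖ :=
      mul_le_mul_of_nonneg_right (D.period_mul_angle_le hkn) (norm_nonneg x)
    have h2 : (1 / 4 : ℝ) ^ n * ‖x‖ ≤ (1 / 2) ^ k * (1 / 2) ^ n * ‖x‖ := by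
      have h3 : (1 / 4 : ℝ) ^ n = (1 / 2) ^ n * (1 / 2) ^ n := by rw [← mul_pow]; norm_num
      have h4 : (1 / 2 : ℝ) ^ n ≤ (1 / 2) ^ k :=
        pow_le_pow_of_le_one (by norm_num) (by norm_num) hkn
      rw [h3]
      gcongr
    have h0 : 0 ≤ (1 / 4 : ℝ) ^ n * ‖x‖ := by positivity
    rcases hkn.eq_or_lt with rfl | hkn
    · rw [if_pos rfl, D.weight_mul_period]
      linarith
    · rw [if_neg hkn.ne']
      have h3 : D.weight n * D.period k * ‖D.driver n x‖ ≤ (1 / 4) ^ n * (2 * ‖x‖) := by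
        gcongr
        exacts [D.weight_mul_period_le hkn, D.norm_driver_apply_le n x]
      linarith

theorem mem_recurrentVectors
    (hs : ∀ z : 𝕜, ‖z‖ ≤ 1 → ∀ ε > 0, ∃ᶠ k in atTop, D.Q k * ‖z - D.s k‖ < ε) {x : X}
    (hx : ‖D.f 0 x‖ ≤ ‖D.f 1 x‖) : x ∈ recurrentVectors D.operator := by
  have hdriver : ∀ ε > 0, ∃ᶠ k in atTop, D.Q k * ‖D.driver k x‖ < ε := fun ε hε => by
    rcases eq_or_ne (D.f 1 x) 0 with h1 | h1
    · have h0 : D.f 0 x = 0 := by simpa [h1] using hx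
      refine Frequently.of_forall fun k => ?_
      simpa [driver_apply, h0, h1] using hε
    · -- The driving functionals nearly vanish at `x` when `s k` is close to `-(f 0 x / f 1 x)`.
      have hpos : 0 < ‖D.f 1 x‖ := norm_pos_iff.2 h1
      have hz : ‖-(D.f 0 x / D.f 1 x)‖ ≤ 1 := by
        rw [norm_neg, norm_div]
        exact div_le_one_of_le₀ hx hpos.le
      refine (hs _ hz (ε / ‖D.f 1 x‖) (by positivity)).mono fun k hk => ?_
      have h2 : D.driver k x = -((-(D.f 0 x / D.f 1 x) - D.s k) * D.f 1 x) := by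
        rw [driver_apply]
        field_simp
        ring
      rw [h2, norm_neg, norm_mul, ← mul_assoc]
      exact (lt_div_iff₀ hpos).1 hk
  refine mem_recurrentVectors_of_frequently fun ε hε => ?_
  have hsmall : ∀ᶠ k : ℕ in atTop, 288 * ‖x‖ * (1 / 2 : ℝ) ^ k < ε / 2 := by
    refine Tendsto.eventually_lt_const (half_pos hε) ?_
    simpa using (tendsto_pow_atTop_nhds_zero_of_lt_one (r := (1 / 2 : ℝ)) (by norm_num)
      (by norm_num)).const_mul (288 * ‖x‖)
  refine D.tendsto_period.frequently
    (((hdriver (ε / 48) (by positivity)).and_eventually hsmall).mono fun k hk => ?_)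
  have h1 := D.norm_operator_pow_period_sub_le k x
  linarith [hk.1, hk.2]

end SpiralData

theorem theorem1p1 {𝕜 : Type*} [RCLike 𝕜] {X : Type*} [NormedAddCommGroup X] [NormedSpace 𝕜 X]
    [CompleteSpace X] [TopologicalSpace.SeparableSpace X] (hX : ¬ FiniteDimensional 𝕜 X) :
    ∃ R K : X →L[𝕜] X,
      R = ContinuousLinearMap.id 𝕜 X + K ∧
      IsCompactOperator K ∧
      IsNuclearOperator K ∧
      Disjoint (orbitsToInfinity R) (recurrentVectors R) ∧
      orbitsToInfinity R ∪ recurrentVectors R = Set.univ ∧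
      (interior (orbitsToInfinity R)).Nonempty ∧
      (interior (recurrentVectors R)).Nonempty := by
  obtain ⟨e, f, he, hf, hfe⟩ := exists_bounded_biorthogonal hX
  obtain ⟨s, Q, hs, hQ, hQtop, happrox⟩ := exists_seq_frequently_mul_norm_sub_lt 𝕜
  let D : SpiralData 𝕜 X := ⟨e, f, s, Q, he, hf, hfe, hs, hQ⟩
  have hA : {x | ‖f 1 x‖ < ‖f 0 x‖} ⊆ orbitsToInfinity D.operator :=
    fun x hx => D.mem_orbitsToInfinity hQtop hx
  have hB : {x | ‖f 0 x‖ ≤ ‖f 1 x‖} ⊆ recurrentVectors D.operator :=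
    fun x hx => D.mem_recurrentVectors happrox hx
  refine ⟨D.operator, D.perturbation, rfl, D.isNuclearOperator_perturbation.isCompactOperator,
    D.isNuclearOperator_perturbation, disjoint_orbitsToInfinity_recurrentVectors _, ?_, ?_, ?_⟩
  · refine Set.eq_univ_of_forall fun x => ?_
    rcases lt_or_ge ‖f 1 x‖ ‖f 0 x‖ with h | h
    exacts [Or.inl (hA h), Or.inr (hB h)]
  · refine ⟨e 0, interior_maximal hA (isOpen_lt (f 1).continuous.norm (f 0).continuous.norm) ?_⟩
    simp [hfe]
  · refine ⟨e 1, interior_maximal (fun x (hx : ‖f 0 x‖ < ‖f 1 x‖) => hB hx.le)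
      (isOpen_lt (f 0).continuous.norm (f 1).continuous.norm) ?_⟩
    change ‖f 0 (e 1)‖ < ‖f 1 (e 1)‖
    simp [hfe]
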